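/- Let $\mathcal M$ and $\mathcal N$ be von Neumann algebras acting on complex Hilbert spaces, equipped with faithful normal tracial states $\tau$ and $\tau'$. Let $L^2(\mathcal M,\tau)$ be the Hilbert space completion of $\mathcal M$ for $\langle X,Y\rangle_\tau=\tau(X^*Y)$, with norm $\|\cdot\|_2$; its positive elements are the $L^2$-limits of positive elements of $\mathcal M$, left and right multiplications by elements of $\mathcal M$ and the trace $\tau$ extend to it by continuity, and so does $(X,Y)\mapsto\tau(XY)$ to pairs of its elements. The same notation is used for $(\mathcal N,\tau')$. Let $\phi:\mathcal M\to\mathcal N$ be a linear, completely positive, trace preserving map ($\tau'\circ\phi=\tau$) that takes positive invertible elements to positive invertible elements. Then $\phi$ extends to a bounded operator $\phi:L^2(\mathcal M,\tau)\to L^2(\mathcal N,\tau')$; let $\phi^*$ be its Hilbert space adjoint. Let $B\in\mathcal M$ be positive and invertible with $\tau(B)=1$. Define the Petz recovery map $\mathcal R:L^2(\mathcal N,\tau')\to L^2(\mathcal M,\tau)$, the Araki--Masuda norm and the sandwiched quasi-relative entropy by $$\mathcal R(Y)=B^{1/2}\,\phi^*\big(\phi(B)^{-1/2}\,Y\,\phi(B)^{-1/2}\big)\,B^{1/2},\qquad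 \|X\|_{B,2}=\|B^{-1/4}XB^{-1/4}\|_2,$$ $$\mathcal S_2(X|B)=\tau\big[(B^{-1/4}XB^{-1/4})^2\big],$$ and $\mathcal S_2(\cdot\,|\phi(B))$ likewise with $\tau'$ and $\phi(B)$. Then for every positive $A\in L^2(\mathcal M,\tau)$ with $\tau(A)=1$, $$\|A-\mathcal R(\phi(A))\|_{B,2}^2\le \mathcal S_2(A|B)-\mathcal S_2(\phi(A)|\phi(B)),$$ and $\mathcal S_2(A|B)=\mathcal S_2(\phi(A)|\phi(B))$ if and only if $\mathcal R(\phi(A))=A$. -/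

import Mathlib

/-! ### Von Neumann algebras as ordered C⋆-algebras -/

section VonNeumann

variable {H : Type*} [NormedAddCommGroup H] [InnerProductSpace ℂ H] [CompleteSpace H]

instance VonNeumannAlgebra.isClosed_toStarSubalgebra (M : VonNeumannAlgebra H) :
    IsClosed (M.toStarSubalgebra : Set (H →L[ℂ] H)) := by
  rw [M.coe_toStarSubalgebra, ← M.centralizer_centralizer]
  exact Set.isClosed_centralizer _

/-- The order that a von Neumann algebra inherits from the operators on `H` is its
C⋆-algebraic order. -/
instance VonNeumannAlgebra.starOrderedRing_toStarSubalgebra (M : VonNeumannAlgebra H) :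
    StarOrderedRing M.toStarSubalgebra := by
  refine StarOrderedRing.of_nonneg_iff' (fun {x y} h z => ?_) (fun x => ⟨fun hx => ?_, ?_⟩)
  · exact add_le_add_right (a := z.1) (show x.1 ≤ y.1 from h)
  · have hx' : 0 ≤ (x : H →L[ℂ] H) := hx
    have hs : CFC.sqrt (x : H →L[ℂ] H) ∈ M.toStarSubalgebra := by
      rw [VonNeumannAlgebra.mem_carrier, ← M.centralizer_centralizer]
      intro y hy
      have hc : Commute (x : H →L[ℂ] H) y := hy x.1 x.2
      exact (hc.cfcₙ_nnreal _).symm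
    refine ⟨⟨_, hs⟩, Subtype.ext ?_⟩
    change x.1 = star (CFC.sqrt x.1) * CFC.sqrt x.1
    rw [(CFC.sqrt_nonneg x.1).isSelfAdjoint.star_eq, CFC.sqrt_mul_sqrt_self x.1 hx']
  · rintro ⟨s, rfl⟩
    exact star_mul_self_nonneg s.1

end VonNeumann

namespace TracialL2

open scoped ComplexOrder CStarAlgebra InnerProductSpace
open UniformSpace

/-- A faithful normal tracial state. Normality: suprema of bounded increasing nets of positive
elements are preserved. -/
structure TracialState (A : Type*) [CStarAlgebra A] [PartialOrder A] [StarOrderedRing A]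
    extends A →ₚ[ℂ] ℂ where
  map_one : toFun 1 = 1
  map_mul_comm : ∀ x y : A, toFun (x * y) = toFun (y * x)
  faithful : ∀ x : A, toFun (star x * x) = 0 → x = 0
  normal : ∀ (D : Set A) (s : A), D.Nonempty → DirectedOn (· ≤ ·) D → (∀ x ∈ D, 0 ≤ x) →
    IsLUB D s → IsLUB (toFun '' D) (toFun s)

section Single

variable {A : Type*} [CStarAlgebra A] [PartialOrder A] [StarOrderedRing A]

noncomputable instance : CoeFun (TracialState A) (fun _ => A → ℂ) where
  coe τ := τ.toPositiveLinearMap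

variable (τ : TracialState A)

theorem trace_mul_comm (x y : A) : τ (x * y) = τ (y * x) := τ.map_mul_comm x y

/-- The algebra `A` with the inner product `⟪x, y⟫ = τ (x⋆ y)`. -/
abbrev PreL2 : Type _ := τ.toPositiveLinearMap.PreGNS

/-- The Hilbert space `L²(A, τ)`: the completion of `A` for the norm `‖x‖₂ = τ (x⋆ x) ^ (1/2)`. -/
abbrev L2 : Type _ := τ.toPositiveLinearMap.GNS

/-- The canonical map of `A` into `L²(A, τ)`. -/
noncomputable def toL2 (x : A) : L2 τ := ((τ.toPositiveLinearMap.toPreGNS x : PreL2 τ) : L2 τ)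

theorem inner_toL2 (x y : A) : ⟪toL2 τ x, toL2 τ y⟫_ℂ = τ (star x * y) := by
  simp only [toL2, Completion.inner_coe]
  rfl

theorem denseRange_toL2 : DenseRange (toL2 τ) :=
  (Completion.denseRange_coe (α := PreL2 τ)).comp
    τ.toPositiveLinearMap.toPreGNS.surjective.denseRange (Completion.continuous_coe _)

theorem norm_sq_preL2 (x : A) :
    ((‖(τ.toPositiveLinearMap.toPreGNS x : PreL2 τ)‖ ^ 2 : ℝ) : ℂ) = τ (star x * x) := by
  have h := τ.toPositiveLinearMap.preGNS_norm_sq (τ.toPositiveLinearMap.toPreGNS x)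
  rw [PositiveLinearMap.ofPreGNS_toPreGNS] at h
  rw [← h]; push_cast; rfl

theorem norm_preL2_le_of {B : Type*} [CStarAlgebra B] [PartialOrder B] [StarOrderedRing B]
    (σ : TracialState B) {x : A} {y : B} {c : ℝ} (hc : 0 ≤ c)
    (h : σ (star y * y) ≤ (c ^ 2 : ℝ) * τ (star x * x)) :
    ‖(σ.toPositiveLinearMap.toPreGNS y : PreL2 σ)‖ ≤
      c * ‖(τ.toPositiveLinearMap.toPreGNS x : PreL2 τ)‖ := by
  rw [← sq_le_sq₀ (norm_nonneg _) (by positivity), mul_pow, ← Complex.real_le_real,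
    Complex.ofReal_mul, norm_sq_preL2, norm_sq_preL2]
  exact h

/-- Left multiplication by `a ∈ A` on `L²(A, τ)`. -/
noncomputable def leftMul (a : A) : L2 τ →L[ℂ] L2 τ :=
  τ.toPositiveLinearMap.gnsStarAlgHom a

theorem leftMul_toL2 (a x : A) : leftMul τ a (toL2 τ x) = toL2 τ (a * x) := by
  simp only [leftMul, toL2]
  exact τ.toPositiveLinearMap.gnsNonUnitalStarAlgHom_apply_coe

/-- Right multiplication by `a ∈ A` on `A`, bounded for the norm `‖·‖₂`. -/
noncomputable def preRightMul (a : A) : PreL2 τ →L[ℂ] PreL2 τ :=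
  LinearMap.mkContinuous
    (τ.toPositiveLinearMap.toPreGNS.toLinearMap ∘ₗ LinearMap.mulRight ℂ a ∘ₗ
      τ.toPositiveLinearMap.ofPreGNS.toLinearMap) ‖a‖ (fun x => by
    obtain ⟨x, rfl⟩ := τ.toPositiveLinearMap.toPreGNS.surjective x
    refine norm_preL2_le_of τ τ (norm_nonneg _) ?_
    change τ (star (x * a) * (x * a)) ≤ _
    have h1 : x * (a * star a) * star x ≤ (‖a‖ ^ 2) • (x * star x) := by
      have := CStarAlgebra.star_right_conjugate_le_norm_smul (a := x) (b := a * star a)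
        (IsSelfAdjoint.mul_star_self a)
      rwa [CStarRing.norm_self_mul_star, ← sq] at this
    have h2 : τ (x * (a * star a) * star x) ≤ τ ((‖a‖ ^ 2) • (x * star x)) :=
      OrderHomClass.mono τ.toPositiveLinearMap h1
    rw [trace_mul_comm, star_mul]
    calc τ (x * a * (star a * star x)) = τ (x * (a * star a) * star x) := by
          simp only [mul_assoc]
      _ ≤ τ ((‖a‖ ^ 2) • (x * star x)) := h2
      _ = _ := by
        rw [← Complex.coe_smul, map_smul, smul_eq_mul, trace_mul_comm])

/-- Right multiplication by `a ∈ A` on `L²(A, τ)`. -/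
noncomputable def rightMul (a : A) : L2 τ →L[ℂ] L2 τ := (preRightMul τ a).completion

theorem rightMul_toL2 (a x : A) : rightMul τ a (toL2 τ x) = toL2 τ (x * a) :=
  (preRightMul τ a).completion_apply_coe _

/-- The involution of `A`, bounded for the norm `‖·‖₂`. -/
noncomputable def preStar : PreL2 τ →L⋆[ℂ] PreL2 τ :=
  LinearMap.mkContinuous
    { toFun := fun x => τ.toPositiveLinearMap.toPreGNS (star (τ.toPositiveLinearMap.ofPreGNS x))
      map_add' := fun x y => by simp
      map_smul' := fun c x => by simp } 1 (fun x => by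
    obtain ⟨x, rfl⟩ := τ.toPositiveLinearMap.toPreGNS.surjective x
    refine norm_preL2_le_of τ τ zero_le_one ?_
    change τ (star (star x) * star x) ≤ _
    rw [trace_mul_comm, star_star]
    simp)

/-- The extension of the involution of `A` to `L²(A, τ)`. -/
noncomputable def starL2 : L2 τ →L⋆[ℂ] L2 τ := (preStar τ).completion

theorem starL2_toL2 (x : A) : starL2 τ (toL2 τ x) = toL2 τ (star x) :=
  (preStar τ).completion_apply_coe _

/-- The extension of the trace to `L²(A, τ)`. -/
noncomputable def traceL2 (X : L2 τ) : ℂ := ⟪toL2 τ 1, X⟫_ℂ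

theorem traceL2_toL2 (x : A) : traceL2 τ (toL2 τ x) = τ x := by
  simp [traceL2, inner_toL2]

/-- The trace `τ (X Y)` of a product of elements of `L²(A, τ)`: the continuous bilinear extension
of `(x, y) ↦ τ (x y)`. -/
noncomputable def traceMul (X Y : L2 τ) : ℂ := ⟪starL2 τ X, Y⟫_ℂ

theorem continuous_traceMul : Continuous fun p : L2 τ × L2 τ => traceMul τ p.1 p.2 := by
  unfold traceMul
  fun_prop

theorem traceMul_toL2 (x y : A) : traceMul τ (toL2 τ x) (toL2 τ y) = τ (x * y) := by
  simp [traceMul, starL2_toL2, inner_toL2]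

/-- The positive elements of `L²(A, τ)`: the limits of positive elements of `A`. -/
def IsPositiveL2 (X : L2 τ) : Prop := X ∈ closure (toL2 τ '' {x : A | 0 ≤ x})

/-- The bounded operator `X ↦ a X a` on `L²(A, τ)`. -/
noncomputable def sandwich (a : A) : L2 τ →L[ℂ] L2 τ := leftMul τ a ∘L rightMul τ a

theorem sandwich_toL2 (a x : A) : sandwich τ a (toL2 τ x) = toL2 τ (a * x * a) := by
  simp [sandwich, rightMul_toL2, leftMul_toL2, mul_assoc]

/-- The Araki–Masuda norm `‖X‖_{B,2} = ‖B^(-1/4) X B^(-1/4)‖₂`. -/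
noncomputable def arakiMasudaNorm (B : A) (X : L2 τ) : ℝ :=
  ‖sandwich τ (B ^ (-(1 / 4) : ℝ)) X‖

/-- The sandwiched quasi-relative entropy `S₂(X|B) = τ ((B^(-1/4) X B^(-1/4))²)`; the trace is
real for self-adjoint `X`. -/
noncomputable def sandwichedEntropy (X : L2 τ) (B : A) : ℝ :=
  (traceMul τ (sandwich τ (B ^ (-(1 / 4) : ℝ)) X) (sandwich τ (B ^ (-(1 / 4) : ℝ)) X)).re

end Single

section Channel

variable {A₁ A₂ : Type*} [CStarAlgebra A₁] [PartialOrder A₁] [StarOrderedRing A₁]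
  [CStarAlgebra A₂] [PartialOrder A₂] [StarOrderedRing A₂]

theorem quadratic_form_nonneg (N : CStarMatrix (Fin 2) (Fin 2) A₂) (hN : 0 ≤ N) (u v : A₂) :
    0 ≤ star u * N 0 0 * u + star u * N 0 1 * v + star v * N 1 0 * u + star v * N 1 1 * v := by
  rw [StarOrderedRing.nonneg_iff] at hN
  induction hN using AddSubmonoid.closure_induction with
  | mem N h =>
    obtain ⟨T, rfl⟩ := h
    have hw : 0 ≤ star (T 0 0 * u + T 0 1 * v) * (T 0 0 * u + T 0 1 * v) +
        star (T 1 0 * u + T 1 1 * v) * (T 1 0 * u + T 1 1 * v) :=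
      add_nonneg (star_mul_self_nonneg _) (star_mul_self_nonneg _)
    convert hw using 1
    simp only [CStarMatrix.mul_apply, CStarMatrix.star_apply, Fin.sum_univ_two, star_add, star_mul]
    noncomm_ring
  | zero => simp
  | add N N' _ _ h h' =>
    convert add_nonneg h h' using 1
    simp only [CStarMatrix.add_apply]
    noncomm_ring

/-- A Kadison–Schwarz inequality for completely positive maps. -/
theorem kadison_schwarz (φ : A₁ →CP A₂) (x : A₁) :
    star (φ x) * φ x ≤ (‖φ 1‖ + 1) • φ (star x * x) := by
  have hpos {a : A₁} (ha : 0 ≤ a) : 0 ≤ φ a := by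
    simpa using OrderHomClass.mono φ ha
  have hq (u v : A₂) : 0 ≤ star u * φ (star x * x) * u + star u * φ (star x) * v +
      star v * φ x * u + star v * φ 1 * v := by
    have h := quadratic_form_nonneg _ (CompletelyPositiveMapClass.map_cstarMatrix_nonneg' φ 2 _
      (star_mul_self_nonneg (CStarMatrix.ofMatrix !![x, 1; 0, 0]))) u v
    simpa [CStarMatrix.mul_apply, CStarMatrix.star_apply, Fin.sum_univ_two] using h
  have hstar : φ (star x) = star (φ x) :=
    map_star (PositiveLinearMap.ofClass (R := ℂ) φ) x
  rw [hstar] at hq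
  have h1 : star (φ x) * φ 1 * φ x ≤ (‖φ 1‖ + 1) • (star (φ x) * φ x) :=
    (CStarAlgebra.star_left_conjugate_le_norm_smul (.of_nonneg (hpos zero_le_one))).trans
      (smul_le_smul_of_nonneg_right (by simp) (star_mul_self_nonneg _))
  have hc0 : 0 < ‖φ 1‖ + 1 := by positivity
  generalize ‖φ 1‖ + 1 = c at h1 hc0 ⊢
  have h2 : c • (star (φ x) * φ x) ≤ c • (c • φ (star x * x)) := by
    have h3 := (hq (c • 1) (-φ x)).trans (add_le_add_right (by simpa using h1) _)
    rw [← sub_nonneg]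
    convert h3 using 1
    simp only [star_smul, star_one, star_neg, star_trivial, smul_mul_assoc, one_mul,
      mul_smul_comm, mul_one, neg_mul, mul_neg, smul_neg]
    abel
  exact (smul_le_smul_iff_of_pos_left hc0).mp h2

/-- A completely positive trace preserving map which takes positive invertible elements to
positive invertible elements. -/
structure StrictCPTP (τ : TracialState A₁) (σ : TracialState A₂)
    extends CompletelyPositiveMap A₁ A₂ where
  trace_map : ∀ x : A₁, σ (toFun x) = τ x
  strict : ∀ x : A₁, 0 ≤ x → IsUnit x → 0 ≤ toFun x ∧ IsUnit (toFun x)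

variable {τ : TracialState A₁} {σ : TracialState A₂}

noncomputable instance : CoeFun (StrictCPTP τ σ) (fun _ => A₁ → A₂) where
  coe φ := φ.toCompletelyPositiveMap

/-- A channel as a map that is bounded for the norms `‖·‖₂`. -/
noncomputable def preMapL2 (φ : StrictCPTP τ σ) : PreL2 τ →L[ℂ] PreL2 σ :=
  LinearMap.mkContinuous
    (σ.toPositiveLinearMap.toPreGNS.toLinearMap ∘ₗ φ.toCompletelyPositiveMap.toLinearMap ∘ₗ
      τ.toPositiveLinearMap.ofPreGNS.toLinearMap) (√(‖φ 1‖ + 1)) (fun x => by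
    obtain ⟨x, rfl⟩ := τ.toPositiveLinearMap.toPreGNS.surjective x
    refine norm_preL2_le_of τ σ (Real.sqrt_nonneg _) ?_
    change σ (star (φ x) * φ x) ≤ _
    rw [Real.sq_sqrt (by positivity)]
    refine (OrderHomClass.mono σ.toPositiveLinearMap
      (kadison_schwarz φ.toCompletelyPositiveMap x)).trans_eq ?_
    rw [← Complex.coe_smul, map_smul, smul_eq_mul]
    exact congrArg _ (φ.trace_map _))

/-- The extension of a channel to a bounded operator `L²(A₁, τ) → L²(A₂, σ)`. -/
noncomputable def mapL2 (φ : StrictCPTP τ σ) : L2 τ →L[ℂ] L2 σ := (preMapL2 φ).completion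

theorem mapL2_toL2 (φ : StrictCPTP τ σ) (x : A₁) : mapL2 φ (toL2 τ x) = toL2 σ (φ x) :=
  (preMapL2 φ).completion_apply_coe _

/-- The Petz recovery map `R(Y) = B^(1/2) φ⋆(φ(B)^(-1/2) Y φ(B)^(-1/2)) B^(1/2)`, where `φ⋆` is
the adjoint of `φ` for the Hilbert spaces `L²`. -/
noncomputable def petzRecovery (φ : StrictCPTP τ σ) (B : A₁) : L2 σ →L[ℂ] L2 τ :=
  sandwich τ (B ^ ((1 / 2) : ℝ)) ∘L ContinuousLinearMap.adjoint (mapL2 φ) ∘L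
    sandwich σ (φ B ^ (-(1 / 2) : ℝ))

end Channel

end TracialL2

namespace TracialL2

open scoped ComplexOrder CStarAlgebra InnerProductSpace
open UniformSpace

section Multiplications

variable {A : Type*} [CStarAlgebra A] [PartialOrder A] [StarOrderedRing A] (τ : TracialState A)

/-- The bounded operator `X ↦ a X b` on `L²(A, τ)`. -/
noncomputable def twoSidedMul (a b : A) : L2 τ →L[ℂ] L2 τ := leftMul τ a ∘L rightMul τ b

theorem twoSidedMul_toL2 (a b x : A) : twoSidedMul τ a b (toL2 τ x) = toL2 τ (a * x * b) := by
  simp [twoSidedMul, rightMul_toL2, leftMul_toL2, mul_assoc]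

theorem sandwich_eq_twoSidedMul (a : A) : sandwich τ a = twoSidedMul τ a a := rfl

variable {τ} in
theorem ext_toL2 {E : Type*} [NormedAddCommGroup E] [NormedSpace ℂ E] {S T : L2 τ →L[ℂ] E}
    (h : ∀ x, S (toL2 τ x) = T (toL2 τ x)) : S = T :=
  ContinuousLinearMap.ext fun X => congrFun
    ((denseRange_toL2 τ).equalizer S.continuous T.continuous (funext h)) X

theorem twoSidedMul_comp (a b c d : A) :
    twoSidedMul τ a b ∘L twoSidedMul τ c d = twoSidedMul τ (a * c) (d * b) :=
  ext_toL2 fun x => by simp [twoSidedMul_toL2, mul_assoc]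

theorem twoSidedMul_one_one : twoSidedMul τ (1 : A) 1 = 1 :=
  ext_toL2 fun x => by simp [twoSidedMul_toL2]

theorem adjoint_twoSidedMul (a b : A) :
    ContinuousLinearMap.adjoint (twoSidedMul τ a b) = twoSidedMul τ (star a) (star b) := by
  symm
  rw [ContinuousLinearMap.eq_adjoint_iff]
  intro X Y
  induction X, Y using (denseRange_toL2 τ).induction_on₂ with
  | hp => exact isClosed_eq (by fun_prop) (by fun_prop)
  | h x y =>
    rw [twoSidedMul_toL2, twoSidedMul_toL2, inner_toL2, inner_toL2]
    simpa [mul_assoc] using trace_mul_comm τ b (star x * a * y)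

theorem starL2_twoSidedMul (a b : A) (X : L2 τ) :
    starL2 τ (twoSidedMul τ a b X) = twoSidedMul τ (star b) (star a) (starL2 τ X) := by
  induction X using (denseRange_toL2 τ).induction_on with
  | hp => exact isClosed_eq (by fun_prop) (by fun_prop)
  | ih x => simp [twoSidedMul_toL2, starL2_toL2, mul_assoc]

variable {τ}

theorem IsPositiveL2.starL2_eq {X : L2 τ} (hX : IsPositiveL2 τ X) : starL2 τ X = X := by
  refine closure_minimal (t := {X | starL2 τ X = X}) ?_
    (isClosed_eq (by fun_prop) (by fun_prop)) hX
  rintro _ ⟨x, hx, rfl⟩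
  rw [Set.mem_ofPred_eq, starL2_toL2, (IsSelfAdjoint.of_nonneg hx).star_eq]

theorem re_traceMul_self_of_starL2_eq {X : L2 τ} (hX : starL2 τ X = X) :
    (traceMul τ X X).re = ‖X‖ ^ 2 := by
  rw [traceMul, hX, inner_self_eq_norm_sq_to_K]
  norm_cast

theorem rpow_mul_rpow {a : A} (ha : IsUnit a) (x y : ℝ) : a ^ x * a ^ y = a ^ (x + y) :=
  (CFC.rpow_add ha).symm

theorem isSelfAdjoint_rpow (a : A) (x : ℝ) : IsSelfAdjoint (a ^ x) :=
  .of_nonneg CFC.rpow_nonneg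

theorem sandwichedEntropy_eq_norm_sq {X : L2 τ} (hX : starL2 τ X = X) (B : A) :
    sandwichedEntropy τ X B = ‖sandwich τ (B ^ (-(1 / 4) : ℝ)) X‖ ^ 2 := by
  refine re_traceMul_self_of_starL2_eq ?_
  rw [sandwich_eq_twoSidedMul, starL2_twoSidedMul, hX,
    (isSelfAdjoint_rpow _ _).star_eq]

theorem norm_toL2_sq (x : A) : ((‖toL2 τ x‖ ^ 2 : ℝ) : ℂ) = τ (star x * x) := by
  rw [← inner_toL2, inner_self_eq_norm_sq_to_K]
  norm_cast

theorem norm_toL2_star (x : A) : ‖toL2 τ (star x)‖ = ‖toL2 τ x‖ := by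
  rw [← sq_eq_sq₀ (norm_nonneg _) (norm_nonneg _), ← Complex.ofReal_inj, norm_toL2_sq,
    norm_toL2_sq, trace_mul_comm, star_star]

end Multiplications

section Contractions

variable {A₁ A₂ : Type*} [CStarAlgebra A₁] [PartialOrder A₁] [StarOrderedRing A₁]
  [CStarAlgebra A₂] [PartialOrder A₂] [StarOrderedRing A₂]

theorem completelyPositive_map_star (φ : A₁ →CP A₂) (x : A₁) : φ (star x) = star (φ x) :=
  map_star (PositiveLinearMap.ofClass (R := ℂ) φ) x

/-- The Lieb–Ruskai inequality `φ(y)⋆ φ(b²)⁻¹ φ(y) ≤ φ(y⋆ b⁻² y)` for `y = b x`. -/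
theorem lieb_ruskai (φ : A₁ →CP A₂) {b : A₁} {c : A₂} (hb : IsSelfAdjoint b)
    (hc : IsSelfAdjoint c) (hcφ : c * φ (b * b) * c = 1) (x : A₁) :
    star (c * φ (b * x)) * (c * φ (b * x)) ≤ φ (star x * x) := by
  have h := quadratic_form_nonneg _ (CompletelyPositiveMapClass.map_cstarMatrix_nonneg' φ 2 _
    (star_mul_self_nonneg (CStarMatrix.ofMatrix !![b, x; 0, 0]))) (-(c * c * φ (b * x))) 1
  have hs : φ (star x * b) = star (φ (b * x)) := by
    rw [← completelyPositive_map_star, star_mul, hb.star_eq]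
  simp only [CStarMatrix.mul_apply, CStarMatrix.star_apply, Fin.sum_univ_two, CStarMatrix.map_apply,
    CStarMatrix.ofMatrix_apply, Matrix.of_apply, Matrix.cons_val_zero, Matrix.cons_val_one,
    Matrix.cons_val', Matrix.cons_val_fin_one, star_zero, mul_zero, add_zero,
    hb.star_eq, hs] at h
  rw [← sub_nonneg]
  convert h using 1
  generalize φ (b * x) = y at *
  have hq : star y * c * c * φ (b * b) * (c * c * y) = star y * c * c * y := by
    calc _ = star y * c * (c * φ (b * b) * c) * (c * y) := by noncomm_ring
      _ = _ := by rw [hcφ]; noncomm_ring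
  simp only [star_neg, star_mul, hc.star_eq, star_one, one_mul, mul_one, neg_mul, mul_neg, neg_neg,
    ← mul_assoc] at hq ⊢
  rw [hq]
  abel

variable {τ : TracialState A₁} {σ : TracialState A₂}

theorem norm_le_one_of_toL2 {S : L2 τ →L[ℂ] L2 σ}
    (h : ∀ x, ‖S (toL2 τ x)‖ ≤ ‖toL2 τ x‖) : ‖S‖ ≤ 1 := by
  refine S.opNorm_le_bound zero_le_one fun X => ?_
  rw [one_mul]
  induction X using (denseRange_toL2 τ).induction_on with
  | hp => exact isClosed_le (by fun_prop) (by fun_prop)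
  | ih x => exact h x

theorem norm_toL2_map_mul_le (φ : StrictCPTP τ σ) {b : A₁} {c : A₂} (hb : IsSelfAdjoint b)
    (hc : IsSelfAdjoint c) (hcφ : c * φ (b * b) * c = 1) (x : A₁) :
    ‖toL2 σ (c * φ (b * x))‖ ≤ ‖toL2 τ x‖ := by
  rw [← sq_le_sq₀ (norm_nonneg _) (norm_nonneg _), ← Complex.real_le_real, norm_toL2_sq,
    norm_toL2_sq]
  exact (OrderHomClass.mono σ.toPositiveLinearMap
    (lieb_ruskai φ.toCompletelyPositiveMap hb hc hcφ x)).trans_eq (φ.trace_map _)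

theorem norm_leftMul_mapL2_le (φ : StrictCPTP τ σ) {b : A₁} {c : A₂} (hb : IsSelfAdjoint b)
    (hc : IsSelfAdjoint c) (hcφ : c * φ (b * b) * c = 1) :
    ‖twoSidedMul σ c 1 ∘L mapL2 φ ∘L twoSidedMul τ b 1‖ ≤ 1 :=
  norm_le_one_of_toL2 fun x => by
    simpa [twoSidedMul_toL2, mapL2_toL2] using norm_toL2_map_mul_le φ hb hc hcφ x

theorem norm_rightMul_mapL2_le (φ : StrictCPTP τ σ) {b : A₁} {c : A₂} (hb : IsSelfAdjoint b)
    (hc : IsSelfAdjoint c) (hcφ : c * φ (b * b) * c = 1) :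
    ‖twoSidedMul σ 1 c ∘L mapL2 φ ∘L twoSidedMul τ 1 b‖ ≤ 1 :=
  norm_le_one_of_toL2 fun x => by
    have h := norm_toL2_map_mul_le φ hb hc hcφ (star x)
    rw [norm_toL2_star, ← norm_toL2_star, star_mul, hc.star_eq, ← completelyPositive_map_star,
      star_mul, star_star, hb.star_eq] at h
    simpa [twoSidedMul_toL2, mapL2_toL2] using h

/-- A self-adjoint operator similar to a contraction is a contraction. -/
theorem norm_le_one_of_similar {E : Type*} [NormedAddCommGroup E] [InnerProductSpace ℂ E]
    [CompleteSpace E] {W : E →L[ℂ] E} (hW : IsSelfAdjoint W) (u : (E →L[ℂ] E)ˣ)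
    (h : ‖(↑u⁻¹ : E →L[ℂ] E) * W * u‖ ≤ 1) : ‖W‖ ≤ 1 := by
  rcases subsingleton_or_nontrivial E with _ | _
  · simp [Subsingleton.elim W 0]
  have h1 : spectralRadius ℂ ((↑u⁻¹ : E →L[ℂ] E) * W * u) = spectralRadius ℂ W := by
    simp only [spectralRadius, spectrum.units_conjugate']
  have h2 := spectrum.spectralRadius_le_nnnorm (𝕜 := ℂ) ((↑u⁻¹ : E →L[ℂ] E) * W * u)
  rw [h1, hW.spectralRadius_eq_nnnorm] at h2
  exact (show ‖W‖ ≤ _ from ENNReal.coe_le_coe.mp h2).trans h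

/-- Monotonicity of the Araki–Masuda norm under channels, for `B = b ^ 4` and
`φ(B) = c ^ 4`. -/
theorem norm_sandwich_mapL2_sandwich_le (φ : StrictCPTP τ σ) {b b' : A₁} {c c' : A₂}
    (hb : IsSelfAdjoint b) (hb' : IsSelfAdjoint b') (hc : IsSelfAdjoint c)
    (hc' : IsSelfAdjoint c') (hbb' : b * b' = 1) (hb'b : b' * b = 1) (hcc' : c * c' = 1)
    (hc'c : c' * c = 1) (hφ : φ (b * b * (b * b)) = c * c * (c * c)) :
    ‖sandwich σ c' ∘L mapL2 φ ∘L sandwich τ b‖ ≤ 1 := by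
  set T := sandwich σ c' ∘L mapL2 φ ∘L sandwich τ b with hT
  have hbs : IsSelfAdjoint (b * b) := by simpa [sq] using hb.pow 2
  have hcs : IsSelfAdjoint (c' * c') := by simpa [sq] using hc'.pow 2
  have hcφ : c' * c' * φ (b * b * (b * b)) * (c' * c') = 1 := by
    rw [hφ]
    calc _ = c' * (c' * c) * c * (c * (c * c') * c') := by noncomm_ring
      _ = 1 := by simp [hc'c, hcc']
  have hS := norm_leftMul_mapL2_le φ hbs hcs hcφ
  have hS' := norm_rightMul_mapL2_le φ hbs hcs hcφ
  set S := twoSidedMul σ (c' * c') 1 ∘L mapL2 φ ∘L twoSidedMul τ (b * b) 1 with hSdef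
  set S' := twoSidedMul σ 1 (c' * c') ∘L mapL2 φ ∘L twoSidedMul τ 1 (b * b) with hSdef'
  have e : S = twoSidedMul σ c' c ∘L T ∘L twoSidedMul τ b b' := by
    refine ext_toL2 fun x => ?_
    simp only [hSdef, hT, sandwich_eq_twoSidedMul, ContinuousLinearMap.comp_apply,
      twoSidedMul_toL2, mapL2_toL2]
    simp [mul_assoc, hb'b, hc'c]
  have e' : S' = twoSidedMul σ c c' ∘L T ∘L twoSidedMul τ b' b := by
    refine ext_toL2 fun x => ?_
    simp only [hSdef', hT, sandwich_eq_twoSidedMul, ContinuousLinearMap.comp_apply,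
      twoSidedMul_toL2, mapL2_toL2]
    simp only [← mul_assoc, hbb', hcc', one_mul]
  let u : (L2 σ →L[ℂ] L2 σ)ˣ :=
    ⟨twoSidedMul σ c c', twoSidedMul σ c' c,
      by rw [ContinuousLinearMap.mul_def, twoSidedMul_comp, hcc', twoSidedMul_one_one],
      by rw [ContinuousLinearMap.mul_def, twoSidedMul_comp, hc'c, twoSidedMul_one_one]⟩
  have key : (↑u⁻¹ : L2 σ →L[ℂ] L2 σ) * (T ∘L ContinuousLinearMap.adjoint T) * u =
      S ∘L ContinuousLinearMap.adjoint S' := by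
    have hone : twoSidedMul τ b b' ∘L twoSidedMul τ b' b = 1 := by
      rw [twoSidedMul_comp, hbb', twoSidedMul_one_one]
    rw [e, e']
    simp only [ContinuousLinearMap.adjoint_comp, adjoint_twoSidedMul, hc.star_eq, hc'.star_eq,
      hb.star_eq, hb'.star_eq]
    ext X
    have := fun Y => DFunLike.congr_fun hone Y
    simp only [ContinuousLinearMap.comp_apply, one_apply_eq_self] at this
    simp [u, this]
  have hTT : ‖T ∘L ContinuousLinearMap.adjoint T‖ ≤ 1 := by
    refine norm_le_one_of_similar ?_ u ?_
    · rw [isSelfAdjoint_iff, ContinuousLinearMap.star_eq_adjoint, ContinuousLinearMap.adjoint_comp,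
        ContinuousLinearMap.adjoint_adjoint]
    · rw [key]
      refine (ContinuousLinearMap.opNorm_comp_le _ _).trans (mul_le_one₀ hS (norm_nonneg _) ?_)
      rwa [LinearIsometryEquiv.norm_map]
  have h2 := ContinuousLinearMap.norm_adjoint_comp_self (ContinuousLinearMap.adjoint T)
  rw [ContinuousLinearMap.adjoint_adjoint, LinearIsometryEquiv.norm_map] at h2
  rw [h2] at hTT
  nlinarith [norm_nonneg T]

/-- `‖a - T⋆Ta‖² ≤ ‖a‖² - ‖Ta‖²` for a contraction `T`. -/
theorem norm_sub_adjoint_apply_sq_le {E F : Type*} [NormedAddCommGroup E] [InnerProductSpace ℂ E]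
    [CompleteSpace E] [NormedAddCommGroup F] [InnerProductSpace ℂ F] [CompleteSpace F]
    {T : E →L[ℂ] F} (hT : ‖T‖ ≤ 1) (a : E) :
    ‖a - ContinuousLinearMap.adjoint T (T a)‖ ^ 2 ≤ ‖a‖ ^ 2 - ‖T a‖ ^ 2 := by
  have h1 : ‖ContinuousLinearMap.adjoint T (T a)‖ ≤ ‖T a‖ := by
    refine (ContinuousLinearMap.le_opNorm _ _).trans ?_
    rw [LinearIsometryEquiv.norm_map]
    exact mul_le_of_le_one_left (norm_nonneg _) hT
  have h2 := norm_sub_sq (𝕜 := ℂ) a (ContinuousLinearMap.adjoint T (T a))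
  rw [ContinuousLinearMap.adjoint_inner_right, inner_self_eq_norm_sq] at h2
  have h3 := pow_le_pow_left₀ (norm_nonneg _) h1 2
  linarith

theorem norm_apply_sq_of_adjoint_apply_eq {E F : Type*} [NormedAddCommGroup E]
    [InnerProductSpace ℂ E] [CompleteSpace E] [NormedAddCommGroup F] [InnerProductSpace ℂ F]
    [CompleteSpace F] {T : E →L[ℂ] F} {a : E} (h : ContinuousLinearMap.adjoint T (T a) = a) :
    ‖T a‖ ^ 2 = ‖a‖ ^ 2 := by
  rw [← inner_self_eq_norm_sq (𝕜 := ℂ) (T a), ← ContinuousLinearMap.adjoint_inner_right, h,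
    inner_self_eq_norm_sq]

theorem starL2_mapL2 (φ : StrictCPTP τ σ) (X : L2 τ) :
    starL2 σ (mapL2 φ X) = mapL2 φ (starL2 τ X) := by
  induction X using (denseRange_toL2 τ).induction_on with
  | hp => exact isClosed_eq (by fun_prop) (by fun_prop)
  | ih x =>
    rw [mapL2_toL2, starL2_toL2, starL2_toL2, mapL2_toL2, completelyPositive_map_star]

/-- The recovery bound and its equality case, for a self-adjoint element of `L²`. -/
theorem petzRecovery_bound (φ : StrictCPTP τ σ) {B : A₁} (hB : 0 ≤ B) (hBu : IsUnit B)
    {X : L2 τ} (hX : starL2 τ X = X) :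
    arakiMasudaNorm τ B (X - petzRecovery φ B (mapL2 φ X)) ^ 2 ≤
        sandwichedEntropy τ X B - sandwichedEntropy σ (mapL2 φ X) (φ B) ∧
      (sandwichedEntropy τ X B = sandwichedEntropy σ (mapL2 φ X) (φ B) ↔
        petzRecovery φ B (mapL2 φ X) = X) := by
  obtain ⟨hC, hCu⟩ := φ.strict B hB hBu
  change 0 ≤ φ B at hC
  change IsUnit (φ B) at hCu
  have hT : ‖sandwich σ (φ B ^ (-(1 / 4) : ℝ)) ∘L mapL2 φ ∘L sandwich τ (B ^ (1 / 4 : ℝ))‖ ≤ 1 := by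
    refine norm_sandwich_mapL2_sandwich_le φ (b' := B ^ (-(1 / 4) : ℝ)) (c := φ B ^ (1 / 4 : ℝ))
      (isSelfAdjoint_rpow _ _) (isSelfAdjoint_rpow _ _) (isSelfAdjoint_rpow _ _) (isSelfAdjoint_rpow _ _) ?_ ?_ ?_ ?_ ?_
    · rw [rpow_mul_rpow hBu, add_neg_cancel, CFC.rpow_zero _ hB]
    · rw [rpow_mul_rpow hBu, neg_add_cancel, CFC.rpow_zero _ hB]
    · rw [rpow_mul_rpow hCu, add_neg_cancel, CFC.rpow_zero _ hC]
    · rw [rpow_mul_rpow hCu, neg_add_cancel, CFC.rpow_zero _ hC]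
    · simp only [rpow_mul_rpow hBu, rpow_mul_rpow hCu]
      norm_num [CFC.rpow_one _ hB, CFC.rpow_one _ hC]
  set T := sandwich σ (φ B ^ (-(1 / 4) : ℝ)) ∘L mapL2 φ ∘L sandwich τ (B ^ (1 / 4 : ℝ)) with hTdef
  set a := sandwich τ (B ^ (-(1 / 4) : ℝ)) X with ha
  have hinv (Y : L2 τ) :
      sandwich τ (B ^ (1 / 4 : ℝ)) (sandwich τ (B ^ (-(1 / 4) : ℝ)) Y) = Y := by
    rw [← ContinuousLinearMap.comp_apply, sandwich_eq_twoSidedMul, sandwich_eq_twoSidedMul,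
      twoSidedMul_comp, rpow_mul_rpow hBu, rpow_mul_rpow hBu, add_neg_cancel, neg_add_cancel, CFC.rpow_zero _ hB,
      twoSidedMul_one_one, one_apply_eq_self]
  have hTa : T a = sandwich σ (φ B ^ (-(1 / 4) : ℝ)) (mapL2 φ X) := by
    simp only [hTdef, ha, ContinuousLinearMap.comp_apply, hinv]
  have hR : sandwich τ (B ^ (-(1 / 4) : ℝ)) (petzRecovery φ B (mapL2 φ X)) =
      ContinuousLinearMap.adjoint T (T a) := by
    have h1 : sandwich τ (B ^ (-(1 / 4) : ℝ)) ∘L sandwich τ (B ^ (1 / 2 : ℝ)) =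
        sandwich τ (B ^ (1 / 4 : ℝ)) := by
      simp only [sandwich_eq_twoSidedMul, twoSidedMul_comp, rpow_mul_rpow hBu]
      norm_num
    have h2 : sandwich σ (φ B ^ (-(1 / 4) : ℝ)) ∘L sandwich σ (φ B ^ (-(1 / 4) : ℝ)) =
        sandwich σ (φ B ^ (-(1 / 2) : ℝ)) := by
      simp only [sandwich_eq_twoSidedMul, twoSidedMul_comp, rpow_mul_rpow hCu]
      norm_num
    have h3 : ContinuousLinearMap.adjoint T = sandwich τ (B ^ (1 / 4 : ℝ)) ∘L
        ContinuousLinearMap.adjoint (mapL2 φ) ∘L sandwich σ (φ B ^ (-(1 / 4) : ℝ)) := by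
      simp only [hTdef, ContinuousLinearMap.adjoint_comp, sandwich_eq_twoSidedMul,
        adjoint_twoSidedMul, (isSelfAdjoint_rpow _ _).star_eq, ContinuousLinearMap.comp_assoc]
    rw [hTa, h3, petzRecovery, ← h1, ← h2]
    rfl
  have hnorm : arakiMasudaNorm τ B (X - petzRecovery φ B (mapL2 φ X)) =
      ‖a - ContinuousLinearMap.adjoint T (T a)‖ := by
    rw [arakiMasudaNorm, map_sub, hR]
  rw [hnorm, sandwichedEntropy_eq_norm_sq hX,
    sandwichedEntropy_eq_norm_sq (by rw [starL2_mapL2, hX]), ← hTa]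
  have hle := norm_sub_adjoint_apply_sq_le hT a
  refine ⟨hle, fun h => ?_, fun h => ?_⟩
  · rw [h, sub_self] at hle
    have h0 : a = ContinuousLinearMap.adjoint T (T a) := by
      rw [← sub_eq_zero, ← norm_eq_zero]
      exact pow_eq_zero_iff two_ne_zero |>.mp (le_antisymm hle (sq_nonneg _))
    rw [← hinv (petzRecovery φ B (mapL2 φ X)), hR, ← h0, ha, hinv]
  · rw [h, ← ha] at hR
    exact (norm_apply_sq_of_adjoint_apply_eq hR.symm).symm

end Contractions

end TracialL2

theorem mainTheorem3
    {H : Type*} [NormedAddCommGroup H] [InnerProductSpace ℂ H] [CompleteSpace H]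
    {K : Type*} [NormedAddCommGroup K] [InnerProductSpace ℂ K] [CompleteSpace K]
    (M : VonNeumannAlgebra H) (N : VonNeumannAlgebra K)
    (τ : TracialL2.TracialState M.toStarSubalgebra) (σ : TracialL2.TracialState N.toStarSubalgebra)
    (φ : TracialL2.StrictCPTP τ σ)
    (B : M.toStarSubalgebra) (hB : 0 ≤ B) (hBu : IsUnit B) (hB1 : τ B = 1)
    (A : TracialL2.L2 τ) (hA : TracialL2.IsPositiveL2 τ A) (hA1 : TracialL2.traceL2 τ A = 1) :
    TracialL2.arakiMasudaNorm τ B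
        (A - TracialL2.petzRecovery φ B (TracialL2.mapL2 φ A)) ^ 2 ≤
      TracialL2.sandwichedEntropy τ A B -
        TracialL2.sandwichedEntropy σ (TracialL2.mapL2 φ A) (φ B) ∧
    (TracialL2.sandwichedEntropy τ A B =
        TracialL2.sandwichedEntropy σ (TracialL2.mapL2 φ A) (φ B) ↔
      TracialL2.petzRecovery φ B (TracialL2.mapL2 φ A) = A) := 
  TracialL2.petzRecovery_bound φ hB hBu hA.starL2_eq
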